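/- All systems are finite-dimensional. A state is a positive semidefinite operator of trace one, a channel is a completely positive trace-preserving linear map, and a state of a bipartite system $A:B$ is separable if it is a convex combination of product states $\alpha\otimes\beta$. A channel from $A:B$ to $A':B'$ is separability-preserving if it maps separable states to separable states. Let $\Phi=|\Phi\rangle\langle\Phi|$ with $|\Phi\rangle=(|00\rangle+|11\rangle)/\sqrt2$, and regard $\Phi^{\otimes m}$ as a state shared between the holder of the first qubits and the holder of the second qubits. Let $\mathcal{O}$ be a class of free operations between bipartite systems (for every pair of an input and an output system, a set of maps) such that 1. every operation in $\mathcal{O}$ is separability-preserving; 2. $\mathcal{O}$ contains the local unitary operations assisted by shared classical randomness, i.e. all maps $X\mapsto\sum_i p_i\,(U_i\otimes V_i)X(U_i\otimes V_i)^\dagger$ with $(p_i)$ a finite probability distribution and $U_i,V_i$ unitary; 3. an operation in $\mathcal{O}$ followed by an operation as in 2 is again in $\mathcal{O}$; 4. separable states can be prepared for free: $X\mapsto \operatorname{Tr}(X)\,\sigma$ is in $\mathcal{O}$ for every separable state $\sigma$. (One-way LOCC is an example.) For a bipartite state $\rho$ and a positive integer $m$, let $$f_{\mathcal{O}}(\rho,m)=\sup_{\Lambda\in\mathcal{O}}\operatorname{Tr}[\Lambda(\rho)\Phi^{\otimes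 m}]$$ be the singlet fraction, and for $\varepsilon\in[0,1]$ let $$C^\varepsilon(\rho,m)=\inf\Big\{\lambda_++\lambda_- \;:\; \tfrac12\big\|\Phi^{\otimes m}-(\lambda_+\Lambda_+(\rho)-\lambda_-\Lambda_-(\rho))\big\|_1\le\varepsilon,\ \lambda_\pm\ge0,\ \lambda_+-\lambda_-=1,\ \Lambda_\pm\in\mathcal{O}\Big\}\in[1,\infty]$$ be the virtual resource distillation overhead, where $\Lambda,\Lambda_\pm$ range over the operations in $\mathcal{O}$ from the system of $\rho$ to that of $\Phi^{\otimes m}$, and $\inf\emptyset=\infty$. Then, for every bipartite state $\rho$, every integer $m\ge1$ and every $\varepsilon\in[0,1]$, one has $f_{\mathcal{O}}(\rho,m)>0$ and $$C^\varepsilon(\rho,m)=\max\left\{\frac{2(1-\varepsilon)}{f_{\mathcal{O}}(\rho,m)}-1,\;1\right\}.$$ Moreover, the supremum defining $f_{\mathcal{O}}(\rho,m)$ is a maximum whenever the set of operations in $\mathcal{O}$ from the system of $\rho$ to that of $\Phi^{\otimes m}$ is closed. -/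

import Mathlib

open scoped Matrix Kronecker ComplexOrder

noncomputable section

namespace VirtualDistillation

/-- Linear maps from operators on `ℂ^S` to operators on `ℂ^T`, written as matrices indexed by finite
types. -/
abbrev LinOp (S T : Type) : Type := Matrix S S ℂ →ₗ[ℂ] Matrix T T ℂ

/-- Quantum states: positive semidefinite operators of trace one. -/
def IsState {S : Type} [Fintype S] (ρ : Matrix S S ℂ) : Prop :=
  ρ.PosSemidef ∧ ρ.trace = 1

/-- The map `id ⊗ Λ`, applied to an operator on `ℂ^K ⊗ ℂ^S`: `Λ` acts on each `S`-block. -/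
def ampliation (K : Type) {S T : Type} (Λ : LinOp S T) (X : Matrix (K × S) (K × S) ℂ) :
    Matrix (K × T) (K × T) ℂ :=
  Matrix.of fun p q => Λ (Matrix.of fun x y => X (p.1, x) (q.1, y)) p.2 q.2

/-- Complete positivity: `id_n ⊗ Λ` preserves positive semidefiniteness for every `n`. -/
def IsCompletelyPositive {S T : Type} (Λ : LinOp S T) : Prop :=
  ∀ (n : ℕ) (X : Matrix (Fin n × S) (Fin n × S) ℂ),
    X.PosSemidef → (ampliation (Fin n) Λ X).PosSemidef

/-- Quantum channels: completely positive trace-preserving maps. -/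
def IsChannel {S T : Type} [Fintype S] [Fintype T] (Λ : LinOp S T) : Prop :=
  IsCompletelyPositive Λ ∧ ∀ X : Matrix S S ℂ, (Λ X).trace = X.trace

/-- Separable states of the bipartite system `A : B`: convex combinations of product states. -/
def IsSeparable {A B : Type} [Fintype A] [Fintype B] (σ : Matrix (A × B) (A × B) ℂ) : Prop :=
  σ ∈ convexHull ℝ {τ : Matrix (A × B) (A × B) ℂ |
    ∃ (α : Matrix A A ℂ) (β : Matrix B B ℂ), IsState α ∧ IsState β ∧ τ = α ⊗ₖ β}

/-- Separability-preserving operations: channels that map separable states to separable states. -/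
def IsSeparabilityPreserving {A B A' B' : Type} [Fintype A] [Fintype B] [Fintype A'] [Fintype B']
    (Λ : LinOp (A × B) (A' × B')) : Prop :=
  IsChannel Λ ∧ ∀ σ : Matrix (A × B) (A × B) ℂ, IsSeparable σ → IsSeparable (Λ σ)

/-- The conjugation `X ↦ W X W†`. -/
def conjugation {S : Type} [Fintype S] (W : Matrix S S ℂ) : LinOp S S :=
  LinearMap.mulLeft ℂ W ∘ₗ LinearMap.mulRight ℂ Wᴴ

/-- Local unitary operations assisted by shared classical randomness: mixtures of the maps
`X ↦ (U ⊗ V) X (U ⊗ V)†` with `U`, `V` unitary. -/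
def IsRandomLocalUnitary {A B : Type} [Fintype A] [DecidableEq A] [Fintype B] [DecidableEq B]
    (T : LinOp (A × B) (A × B)) : Prop :=
  T ∈ convexHull ℝ {T' : LinOp (A × B) (A × B) |
    ∃ U ∈ Matrix.unitaryGroup A ℂ, ∃ V ∈ Matrix.unitaryGroup B ℂ, T' = conjugation (U ⊗ₖ V)}

/-- The operation that discards its input and prepares `σ`: `X ↦ (Tr X) σ`. -/
def preparation {T : Type} (S : Type) [Fintype S] (σ : Matrix T T ℂ) : LinOp S T :=
  (Matrix.traceLinearMap S ℂ ℂ).smulRight σ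

/-- A class of operations between bipartite systems: for every input system `A : B` and every output
system `A' : B'`, a set of maps. -/
abbrev OperationClass : Type 1 := ∀ A B A' B' : Type, Set (LinOp (A × B) (A' × B'))

/-- The trace norm: the sum of the singular values. -/
def traceNorm {S : Type} [Fintype S] [DecidableEq S] (X : Matrix S S ℂ) : ℝ :=
  ∑ i, Real.sqrt ((Matrix.isHermitian_conjTranspose_mul_self X).eigenvalues i)

/-- The Bell vector `(|00⟩ + |11⟩) / √2`. -/
def bellKet : Fin 2 × Fin 2 → ℂ := fun p => if p.1 = p.2 then ((1 / Real.sqrt 2 : ℝ) : ℂ) else 0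

/-- The Bell state `Φ = |Φ⟩⟨Φ|`. -/
def bellState : Matrix (Fin 2 × Fin 2) (Fin 2 × Fin 2) ℂ := Matrix.vecMulVec bellKet (star bellKet)

/-- One party's share of `m` qubit pairs. -/
abbrev Qubits (m : ℕ) : Type := Fin m → Fin 2

/-- The tensor power `Φ^{⊗m}`, as an operator on the bipartite system consisting of the first
qubits of all `m` pairs and the second qubits of all `m` pairs. -/
def bellPower (m : ℕ) : Matrix (Qubits m × Qubits m) (Qubits m × Qubits m) ℂ :=
  Matrix.of fun p q => ∏ i, bellState (p.1 i, p.2 i) (q.1 i, q.2 i)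

/-- The singlet fraction of `ρ` with respect to the class `O`: the best overlap with `Φ^{⊗m}`
reachable from `ρ`. -/
def singletFraction (O : OperationClass) {A B : Type} (ρ : Matrix (A × B) (A × B) ℂ) (m : ℕ) : ℝ :=
  sSup {t : ℝ | ∃ Λ ∈ O A B (Qubits m) (Qubits m), t = (Λ ρ * bellPower m).trace.re}

/-- The virtual resource distillation overhead of `ρ` for the target `Φ^{⊗m}` with error `ε`; its
value is `⊤` if there is no admissible decomposition. -/
def virtualOverhead (O : OperationClass) {A B : Type} (ε : ℝ) (ρ : Matrix (A × B) (A × B) ℂ)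
    (m : ℕ) : EReal :=
  sInf {c : EReal | ∃ (lp lm : ℝ) (Λp Λm : LinOp (A × B) (Qubits m × Qubits m)),
    Λp ∈ O A B (Qubits m) (Qubits m) ∧ Λm ∈ O A B (Qubits m) (Qubits m) ∧
    0 ≤ lp ∧ 0 ≤ lm ∧ lp - lm = 1 ∧
    (1 / 2 : ℝ) * traceNorm (bellPower m - (lp • Λp ρ - lm • Λm ρ)) ≤ ε ∧
    c = ((lp + lm : ℝ) : EReal)}

end VirtualDistillation

end

/-! Write `P` for the target, `d` for the local dimension, and `R = (1 - P) / (d ^ 2 - 1)`.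

Lower bound: for an admissible decomposition, the difference between `P` and the virtual state is
Hermitian and traceless, so its overlap with the effect `P` is at most half its trace norm, hence at
most `ε`. Dropping the nonnegative overlap of the subtracted state leaves `1 - ε ≤ lp * f`, and `lp
+ lm = 2 * lp - 1` (`le_mul_overlap_of_traceNorm_le`).

Upper bound: twirling over `U ⊗ Ū` turns a free output of overlap `F` into `F P + (1 - F) R` without
leaving the class (`exists_twirl`). The state `R` is itself a twirled product state, hence separable
and free. Subtracting `(lp - 1) R` from `lp` times the twirled state gives `lp F P + (1 - lp F) R`,
at distance at most `|1 - lp F|` from `P`; the optimal choice is `lp = max ((1 - ε) / F) 1`.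

The twirl must be a finite mixture, so it comes from the point of least Frobenius norm in the convex
hull of a unitary orbit, not from a Haar integral. Attainment of the singlet fraction is
compactness: channels are pointwise uniformly bounded. -/

open scoped Matrix Kronecker ComplexOrder

noncomputable section

namespace VirtualDistillation

/-! ### Trace norm of Hermitian matrices -/

section TraceNorm

variable {S : Type} [Fintype S] [DecidableEq S]

/-- The matrix `M` in the eigenbasis of the Hermitian matrix `X`. -/
def inEigenbasis {X : Matrix S S ℂ} (hX : X.IsHermitian) (M : Matrix S S ℂ) : Matrix S S ℂ :=
  (hX.eigenvectorUnitary : Matrix S S ℂ)ᴴ * M * (hX.eigenvectorUnitary : Matrix S S ℂ)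

lemma inEigenbasis_self {X : Matrix S S ℂ} (hX : X.IsHermitian) :
    inEigenbasis hX X = Matrix.diagonal fun i => (hX.eigenvalues i : ℂ) := by
  have h := hX.conjStarAlgAut_star_eigenvectorUnitary
  rw [Unitary.conjStarAlgAut_star_apply] at h
  exact h

lemma inEigenbasis_mul {X : Matrix S S ℂ} (hX : X.IsHermitian) (M N : Matrix S S ℂ) :
    inEigenbasis hX (M * N) = inEigenbasis hX M * inEigenbasis hX N := by
  have h : (hX.eigenvectorUnitary : Matrix S S ℂ) * (hX.eigenvectorUnitary : Matrix S S ℂ)ᴴ = 1 :=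
    Unitary.coe_mul_star_self _
  simp only [inEigenbasis, Matrix.mul_assoc]
  rw [← Matrix.mul_assoc _ (_ᴴ) (_ * _), h, Matrix.one_mul]

lemma trace_inEigenbasis {X : Matrix S S ℂ} (hX : X.IsHermitian) (M : Matrix S S ℂ) :
    (inEigenbasis hX M).trace = M.trace := by
  have h : (hX.eigenvectorUnitary : Matrix S S ℂ) * (hX.eigenvectorUnitary : Matrix S S ℂ)ᴴ = 1 :=
    Unitary.coe_mul_star_self _
  rw [inEigenbasis, Matrix.trace_mul_comm, ← Matrix.mul_assoc, h, Matrix.one_mul]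

lemma charpoly_inEigenbasis {X : Matrix S S ℂ} (hX : X.IsHermitian) (M : Matrix S S ℂ) :
    (inEigenbasis hX M).charpoly = M.charpoly := by
  have h : (hX.eigenvectorUnitary : Matrix S S ℂ) * (hX.eigenvectorUnitary : Matrix S S ℂ)ᴴ = 1 :=
    Unitary.coe_mul_star_self _
  rw [inEigenbasis, Matrix.charpoly_mul_comm, ← Matrix.mul_assoc, h, Matrix.one_mul]

lemma inEigenbasis_diag_nonneg {X M : Matrix S S ℂ} (hX : X.IsHermitian) (hM : M.PosSemidef)
    (i : S) : 0 ≤ (inEigenbasis hX M i i).re :=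
  (Complex.nonneg_iff.1 (hM.conjTranspose_mul_mul_same
    (hX.eigenvectorUnitary : Matrix S S ℂ)).diag_nonneg).1

/-- The eigenvalues of `Xᴴ * X` and the squared eigenvalues of `X` carry unrelated orderings; they
agree as multisets, being the roots of one characteristic polynomial. -/
lemma traceNorm_eq_sum_abs {X : Matrix S S ℂ} (hX : X.IsHermitian) :
    traceNorm X = ∑ i, |hX.eigenvalues i| := by
  have h1 : (Xᴴ * X).charpoly.roots =
      Multiset.map (fun i => ((hX.eigenvalues i ^ 2 : ℝ) : ℂ)) Finset.univ.val := by
    rw [hX.eq, ← charpoly_inEigenbasis hX, inEigenbasis_mul, inEigenbasis_self,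
      Matrix.diagonal_mul_diagonal, Matrix.charpoly_diagonal, Polynomial.roots_prod]
    · simp_rw [← Complex.ofReal_mul, ← pow_two]
      simp only [Polynomial.roots_X_sub_C, Multiset.bind_singleton]
    · simp_rw [← Complex.ofReal_mul]
      simp [-Complex.ofReal_mul, Finset.prod_ne_zero_iff, Polynomial.X_sub_C_ne_zero]
  rw [(Matrix.isHermitian_conjTranspose_mul_self X).roots_charpoly_eq_eigenvalues] at h1
  have h2 := congrArg (fun s => (Multiset.map (fun z : ℂ => Real.sqrt z.re) s).sum) h1
  simp only [Multiset.map_map, Function.comp_def, Complex.ofReal_re, Real.sqrt_sq_eq_abs] at h2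
  exact h2

/-- A traceless Hermitian operator has overlap at most half its trace norm with an effect. -/
lemma re_trace_mul_le_half_traceNorm {X P : Matrix S S ℂ} (hX : X.IsHermitian)
    (htr : X.trace = 0) (hP : P.PosSemidef) (hP1 : (1 - P).PosSemidef) :
    (X * P).trace.re ≤ (1 / 2 : ℝ) * traceNorm X := by
  have h1 : (X * P).trace.re = ∑ i, hX.eigenvalues i * (inEigenbasis hX P i i).re := by
    rw [← trace_inEigenbasis hX, inEigenbasis_mul, inEigenbasis_self, Matrix.trace]
    simp [Matrix.diagonal_mul]
  have h2 : ∑ i, hX.eigenvalues i = 0 := by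
    have := hX.trace_eq_sum_eigenvalues
    rw [htr] at this
    exact Complex.ofReal_injective (by rw [Complex.ofReal_sum]; exact this.symm)
  -- Since the eigenvalues sum to zero, half the trace norm is the sum of their positive parts. The
  -- claim is then termwise, the diagonal entries of `P` lying in `[0, 1]`.
  have h3 : (1 / 2 : ℝ) * traceNorm X =
      ∑ i, (1 / 2 : ℝ) * (|hX.eigenvalues i| + hX.eigenvalues i) := by
    rw [traceNorm_eq_sum_abs hX, ← Finset.mul_sum, Finset.sum_add_distrib, h2, add_zero]
  rw [h1, h3]
  refine Finset.sum_le_sum fun i _ => ?_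
  have h4 := inEigenbasis_diag_nonneg hX hP i
  have h5 := inEigenbasis_diag_nonneg hX hP1 i
  have h6 : inEigenbasis hX (1 - P) i i = 1 - inEigenbasis hX P i i := by
    have h : (hX.eigenvectorUnitary : Matrix S S ℂ)ᴴ * (hX.eigenvectorUnitary : Matrix S S ℂ) = 1 :=
      Unitary.coe_star_mul_self _
    simp [inEigenbasis, Matrix.mul_sub, Matrix.sub_mul, h]
  rw [h6, Complex.sub_re, Complex.one_re] at h5
  rcases le_total 0 (hX.eigenvalues i) with h | h
  · rw [abs_of_nonneg h]; nlinarith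
  · rw [abs_of_nonpos h]; nlinarith

/-- In the eigenbasis of `c • (P - R)` the diagonals of `P` and `R` are probability vectors, and
each eigenvalue is `c` times their difference. -/
lemma traceNorm_smul_sub_le {P R : Matrix S S ℂ} (hP : IsState P) (hR : IsState R) (c : ℝ) :
    traceNorm (c • (P - R)) ≤ 2 * |c| := by
  have hX : (c • (P - R)).IsHermitian := by
    have := hP.1.isHermitian.sub hR.1.isHermitian
    rw [Matrix.IsHermitian, Matrix.conjTranspose_smul, this.eq, star_trivial]
  rw [traceNorm_eq_sum_abs hX]
  have h1 : ∀ i, hX.eigenvalues i =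
      c * ((inEigenbasis hX P i i).re - (inEigenbasis hX R i i).re) := fun i => by
    have h := congrFun (congrFun (inEigenbasis_self hX) i) i
    rw [Matrix.diagonal_apply_eq] at h
    rw [← Complex.ofReal_re (hX.eigenvalues i), ← h]
    simp only [inEigenbasis, Matrix.mul_smul, Matrix.smul_mul, Matrix.mul_sub, Matrix.sub_mul]
    simp
  have h2 : ∀ M : Matrix S S ℂ, M.trace = 1 → ∑ i, (inEigenbasis hX M i i).re = 1 := fun M hM => by
    rw [← Complex.re_sum]
    have := trace_inEigenbasis hX M
    rw [hM, Matrix.trace] at this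
    simpa using congrArg Complex.re this
  calc ∑ i, |hX.eigenvalues i|
      ≤ ∑ i, |c| * ((inEigenbasis hX P i i).re + (inEigenbasis hX R i i).re) := by
        refine Finset.sum_le_sum fun i _ => ?_
        rw [h1, abs_mul]
        refine mul_le_mul_of_nonneg_left ?_ (abs_nonneg c)
        have := inEigenbasis_diag_nonneg hX hP.1 i
        have := inEigenbasis_diag_nonneg hX hR.1 i
        rw [abs_le]; constructor <;> linarith
    _ = 2 * |c| := by
        rw [← Finset.mul_sum, Finset.sum_add_distrib, h2 P hP.2, h2 R hR.2]; ring

end TraceNorm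

/-! ### Compactness of convex hulls -/

/-- In finite dimension the convex hull of a compact set is compact. -/
lemma isCompact_convexHull_of_isCompact {E : Type*} [AddCommGroup E] [Module ℝ E]
    [TopologicalSpace E] [ContinuousAdd E] [ContinuousSMul ℝ E] [FiniteDimensional ℝ E]
    {s : Set E} (hs : IsCompact s) : IsCompact (convexHull ℝ s) := by
  let K : ℕ → Set E := fun k => (fun p : (Fin k → ℝ) × (Fin k → E) => ∑ i, p.1 i • p.2 i) ''
    (stdSimplex ℝ (Fin k) ×ˢ Set.pi Set.univ fun _ => s)
  have hK : ∀ k, IsCompact (K k) := fun k =>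
    ((isCompact_stdSimplex ℝ (Fin k)).prod (isCompact_univ_pi fun _ => hs)).image
      (continuous_finsetSum _ fun i _ => by fun_prop)
  -- Carathéodory: at most `finrank + 1` points are needed, so `k` stays below `finrank + 2`.
  have heq : convexHull ℝ s = ⋃ k ∈ Finset.range (Module.finrank ℝ E + 2), K k := by
    ext x
    simp only [Set.mem_iUnion, exists_prop]
    constructor
    · intro hx
      obtain ⟨ι, _, z, w, hz, hai, hw, hw1, rfl⟩ := eq_pos_convex_span_of_mem_convexHull hx
      refine ⟨Fintype.card ι, ?_, (w ∘ (Fintype.equivFin ι).symm, z ∘ (Fintype.equivFin ι).symm),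
        ⟨⟨fun i => (hw _).le, ?_⟩, fun i _ => hz ⟨_, rfl⟩⟩, ?_⟩
      · have := hai.card_le_finrank_succ
        have := Submodule.finrank_le (vectorSpan ℝ (Set.range z))
        simp only [Finset.mem_range]; omega
      · rw [← hw1]; exact (Fintype.equivFin ι).symm.sum_comp w
      · exact (Fintype.equivFin ι).symm.sum_comp fun i => w i • z i
    · rintro ⟨k, -, ⟨w, z⟩, ⟨⟨hw, hw1⟩, hz⟩, rfl⟩
      exact (convex_convexHull ℝ s).sum_mem (fun i _ => hw i) hw1
        fun i _ => subset_convexHull ℝ s (hz i trivial)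
  rw [heq]
  exact (Finset.range _).isCompact_biUnion fun k _ => hK k

/-! ### Boundedness of channels -/

section Channels

variable {S T : Type}

lemma IsCompletelyPositive.posSemidef {Λ : LinOp S T} (h : IsCompletelyPositive Λ)
    {X : Matrix S S ℂ} (hX : X.PosSemidef) : (Λ X).PosSemidef :=
  (h 1 _ (hX.submatrix Prod.snd)).submatrix fun t => ((0 : Fin 1), t)

variable [Fintype S] [Fintype T]

/-- The principal 2 × 2 minor gives `‖M i j‖ ^ 2 ≤ M i i * M j j`, and each diagonal entry is at
most the trace. -/
lemma norm_apply_le_trace {M : Matrix T T ℂ} (hM : M.PosSemidef) (i j : T) :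
    ‖M i j‖ ≤ M.trace.re := by
  classical
  have hd : ∀ k, 0 ≤ (M k k).re := fun k => (Complex.nonneg_iff.1 hM.diag_nonneg).1
  have hle : ∀ k, (M k k).re ≤ M.trace.re := fun k => by
    rw [Matrix.trace, Complex.re_sum]
    exact Finset.single_le_sum (f := fun k => (M k k).re) (fun k _ => hd k) (Finset.mem_univ k)
  have him : ∀ k, (M k k).im = 0 := fun k => ((Complex.nonneg_iff.1 hM.diag_nonneg).2).symm
  have h2 := (hM.submatrix ![i, j]).det_nonneg
  rw [Matrix.det_fin_two] at h2
  simp only [Matrix.submatrix_apply, Matrix.cons_val_zero, Matrix.cons_val_one] at h2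
  rw [← hM.isHermitian.apply i j, ← starRingEnd_apply, ← Complex.normSq_eq_conj_mul_self] at h2
  have h3 := (Complex.nonneg_iff.1 h2).1
  rw [Complex.sub_re, Complex.ofReal_re, Complex.mul_re, him, him, Complex.normSq_eq_norm_sq] at h3
  have h4 : ‖M i j‖ = ‖M j i‖ := by rw [← hM.isHermitian.apply i j, norm_star]
  rw [h4]
  refine abs_le_of_sq_le_sq' ?_ ((hd i).trans (hle i)) |>.2
  nlinarith [hd i, hd j, hle i, hle j]

/-- For positive semidefinite `X` the trace is a bound common to all channels; such matrices span,
and bounds pass to linear combinations. -/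
lemma exists_norm_channel_apply_le (X : Matrix S S ℂ) :
    ∃ c : ℝ, ∀ Λ : LinOp S T, IsChannel Λ → ∀ i j, ‖Λ X i j‖ ≤ c := by
  classical
  have hX : X ∈ Submodule.span ℂ {Y : Matrix S S ℂ | Y.PosSemidef} := by
    open scoped MatrixOrder Matrix.Norms.L2Operator in
    have := CStarAlgebra.span_nonneg (A := Matrix S S ℂ)
    simp only [Matrix.nonneg_iff_posSemidef] at this
    rw [this]; trivial
  induction hX using Submodule.span_induction with
  | mem Y hY =>
    exact ⟨Y.trace.re, fun Λ hΛ i j => hΛ.2 Y ▸ norm_apply_le_trace (hΛ.1.posSemidef hY) i j⟩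
  | zero => exact ⟨0, fun Λ _ i j => by simp⟩
  | add Y Z _ _ hY hZ =>
    obtain ⟨c, hc⟩ := hY
    obtain ⟨d, hd⟩ := hZ
    refine ⟨c + d, fun Λ hΛ i j => ?_⟩
    rw [map_add]
    exact (norm_add_le _ _).trans (add_le_add (hc Λ hΛ i j) (hd Λ hΛ i j))
  | smul a Y _ hY =>
    obtain ⟨c, hc⟩ := hY
    refine ⟨‖a‖ * c, fun Λ hΛ i j => ?_⟩
    rw [map_smul, Matrix.smul_apply, norm_smul]
    exact mul_le_mul_of_nonneg_left (hc Λ hΛ i j) (norm_nonneg a)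

/-- A pointwise closed set of channels is compact. -/
lemma isCompact_of_isClosed_channels {F : Set (Matrix S S ℂ → Matrix T T ℂ)} (hF : IsClosed F)
    (hch : ∀ g ∈ F, ∃ Λ : LinOp S T, IsChannel Λ ∧ g = ⇑Λ) : IsCompact F := by
  choose c hc using exists_norm_channel_apply_le (S := S) (T := T)
  -- Tychonoff: in the topology of pointwise convergence, the uniform bounds place all channels in
  -- one product of closed balls.
  have hK : IsCompact (Set.pi Set.univ fun X : Matrix S S ℂ =>
      Set.pi Set.univ fun _ : T => Set.pi Set.univ fun _ : T => Metric.closedBall (0 : ℂ) (c X)) :=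
    isCompact_univ_pi fun X => isCompact_univ_pi fun _ => isCompact_univ_pi fun _ =>
      isCompact_closedBall _ _
  refine hK.of_isClosed_subset hF fun g hg => ?_
  obtain ⟨Λ, hΛ, rfl⟩ := hch g hg
  intro X _ i _ j _
  simpa using hc X Λ hΛ i j

end Channels

/-! ### The twirling operation -/

section Twirl

variable {n : Type} [Fintype n] [DecidableEq n]

/-- The maximally entangled state on two copies of `ℂ^n`. -/
def maxEntangled (n : Type) [Fintype n] [DecidableEq n] : Matrix (n × n) (n × n) ℂ :=
  Matrix.of fun p q => if p.1 = p.2 ∧ q.1 = q.2 then (Fintype.card n : ℂ)⁻¹ else 0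

/-- The state proportional to the complement of the maximally entangled state. -/
def complementState (n : Type) [Fintype n] [DecidableEq n] : Matrix (n × n) (n × n) ℂ :=
  ((Fintype.card n : ℝ) ^ 2 - 1)⁻¹ • (1 - maxEntangled n)

/-- The bilateral unitary `U ⊗ Ū`. -/
def bilateral (U : Matrix n n ℂ) : Matrix (n × n) (n × n) ℂ := U ⊗ₖ U.map star

lemma map_star_mem_unitaryGroup {U : Matrix n n ℂ} (hU : U ∈ Matrix.unitaryGroup n ℂ) :
    U.map star ∈ Matrix.unitaryGroup n ℂ := by
  rw [Matrix.mem_unitaryGroup_iff] at hU ⊢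
  have h := congrArg (fun M : Matrix n n ℂ => M.map star) hU
  simp only [Matrix.star_eq_conjTranspose] at h ⊢
  ext i j
  have := congrFun (congrFun h i) j
  simp only [Matrix.map_apply, Matrix.mul_apply, star_sum, star_mul', Matrix.one_apply,
    Matrix.conjTranspose_apply, star_star] at this ⊢
  rw [this]
  split_ifs <;> simp

lemma bilateral_mem_unitaryGroup {U : Matrix n n ℂ} (hU : U ∈ Matrix.unitaryGroup n ℂ) :
    bilateral U ∈ Matrix.unitaryGroup (n × n) ℂ :=
  Matrix.kronecker_mem_unitary hU (map_star_mem_unitaryGroup hU)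

omit [DecidableEq n] in
lemma bilateral_mul (U V : Matrix n n ℂ) : bilateral (U * V) = bilateral U * bilateral V := by
  rw [bilateral, bilateral, bilateral, ← Matrix.mul_kronecker_mul]
  congr 1
  ext i j
  simp [Matrix.mul_apply]

lemma conjugation_apply {S : Type} [Fintype S] (W X : Matrix S S ℂ) :
    conjugation W X = W * (X * Wᴴ) := rfl

lemma conjugation_mul {S : Type} [Fintype S] (V W X : Matrix S S ℂ) :
    conjugation (V * W) X = conjugation V (conjugation W X) := by
  simp only [conjugation_apply, Matrix.conjTranspose_mul, Matrix.mul_assoc]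

lemma conjugation_eq_self_iff {S : Type} [Fintype S] [DecidableEq S] {W : Matrix S S ℂ}
    (hW : W ∈ Matrix.unitaryGroup S ℂ) (X : Matrix S S ℂ) :
    conjugation W X = X ↔ W * X = X * W := by
  have h1 : W * Wᴴ = 1 := Matrix.mem_unitaryGroup_iff.1 hW
  have h2 : Wᴴ * W = 1 := Matrix.mem_unitaryGroup_iff'.1 hW
  rw [conjugation_apply, ← Matrix.mul_assoc]
  constructor
  · intro h
    rw [← congrArg (· * W) h]
    simp only [Matrix.mul_assoc, h2, Matrix.mul_one]
  · intro h
    rw [h, Matrix.mul_assoc, h1, Matrix.mul_one]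

/-- The squared Frobenius norm. -/
def frobSq {S : Type} [Fintype S] (X : Matrix S S ℂ) : ℝ := (Xᴴ * X).trace.re

lemma frobSq_eq {S : Type} [Fintype S] (X : Matrix S S ℂ) :
    frobSq X = ∑ j, ∑ i, ‖X i j‖ ^ 2 := by
  simp only [frobSq, Matrix.trace, Matrix.diag, Matrix.mul_apply, Matrix.conjTranspose_apply,
    Complex.re_sum]
  refine Finset.sum_congr rfl fun j _ => Finset.sum_congr rfl fun i _ => ?_
  rw [← starRingEnd_apply, ← Complex.normSq_eq_conj_mul_self, Complex.ofReal_re,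
    Complex.normSq_eq_norm_sq]

lemma frobSq_conjugation {S : Type} [Fintype S] [DecidableEq S] {W : Matrix S S ℂ}
    (hW : W ∈ Matrix.unitaryGroup S ℂ) (X : Matrix S S ℂ) :
    frobSq (conjugation W X) = frobSq X := by
  have h2 : Wᴴ * W = 1 := Matrix.mem_unitaryGroup_iff'.1 hW
  have h : (conjugation W X)ᴴ * conjugation W X = W * (Xᴴ * X * Wᴴ) := by
    simp only [conjugation_apply, Matrix.conjTranspose_mul, Matrix.conjTranspose_conjTranspose,
      Matrix.mul_assoc]
    rw [← Matrix.mul_assoc Wᴴ W, h2, Matrix.one_mul]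
  rw [frobSq, h, Matrix.trace_mul_comm, Matrix.mul_assoc, h2, Matrix.mul_one, frobSq]

/-- The parallelogram law; its last term makes a minimizer of `frobSq` on a convex set unique. -/
lemma frobSq_midpoint {S : Type} [Fintype S] (X Y : Matrix S S ℂ) :
    frobSq ((1 / 2 : ℝ) • X + (1 / 2 : ℝ) • Y) =
      frobSq X / 2 + frobSq Y / 2 - frobSq (X - Y) / 4 := by
  simp only [frobSq_eq, Finset.sum_div, ← Finset.sum_add_distrib, ← Finset.sum_sub_distrib]
  refine Finset.sum_congr rfl fun j _ => Finset.sum_congr rfl fun i _ => ?_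
  simp only [Matrix.add_apply, Matrix.smul_apply, Matrix.sub_apply, Complex.sq_norm,
    Complex.normSq_apply, Complex.add_re, Complex.add_im, Complex.sub_re, Complex.sub_im,
    Complex.smul_re, Complex.smul_im, smul_eq_mul]
  ring

lemma eq_of_frobSq_sub_nonpos {S : Type} [Fintype S] {X Y : Matrix S S ℂ}
    (h : frobSq (X - Y) ≤ 0) : X = Y := by
  rw [frobSq_eq] at h
  have h0 : ∀ j ∈ Finset.univ, (0 : ℝ) ≤ ∑ i, ‖(X - Y) i j‖ ^ 2 :=
    fun j _ => Finset.sum_nonneg fun i _ => by positivity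
  have h1 := (Finset.sum_eq_zero_iff_of_nonneg h0).1 (le_antisymm h (Finset.sum_nonneg h0))
  ext i j
  have h2 := (Finset.sum_eq_zero_iff_of_nonneg fun i _ => by positivity).1
    (h1 j (Finset.mem_univ j)) i (Finset.mem_univ i)
  simpa [sub_eq_zero] using h2

/-- The conjugations by bilateral unitaries. -/
def bilateralConjugations (n : Type) [Fintype n] [DecidableEq n] : Set (LinOp (n × n) (n × n)) :=
  {T | ∃ U ∈ Matrix.unitaryGroup n ℂ, T = conjugation (bilateral U)}

lemma isRandomLocalUnitary_of_mem {T : LinOp (n × n) (n × n)}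
    (hT : T ∈ convexHull ℝ (bilateralConjugations n)) : IsRandomLocalUnitary T := by
  refine convexHull_mono ?_ hT
  rintro _ ⟨U, hU, rfl⟩
  exact ⟨U, hU, U.map star, map_star_mem_unitaryGroup hU, rfl⟩

lemma isCompact_unitaryGroup :
    IsCompact {U : Matrix n n ℂ | U ∈ Matrix.unitaryGroup n ℂ} := by
  have hK : IsCompact (Set.pi Set.univ fun _ : n => Set.pi Set.univ fun _ : n =>
      Metric.closedBall (0 : ℂ) 1) :=
    isCompact_univ_pi fun _ => isCompact_univ_pi fun _ => isCompact_closedBall _ _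
  refine IsCompact.of_isClosed_subset (X := Matrix n n ℂ) hK ?_ fun U hU i _ j _ => ?_
  · exact isClosed_unitary
  · simpa using entry_norm_bound_of_unitary hU i j

/-- The convex hull of the orbit of `X` under bilateral unitaries contains a fixed point: the
element of least Frobenius norm. -/
lemma exists_bilateral_invariant (X : Matrix (n × n) (n × n) ℂ) :
    ∃ T ∈ convexHull ℝ (bilateralConjugations n), ∀ U ∈ Matrix.unitaryGroup n ℂ,
      conjugation (bilateral U) (T X) = T X := by
  let orbit : Set (Matrix (n × n) (n × n) ℂ) :=
    (fun U => conjugation (bilateral U) X) '' {U | U ∈ Matrix.unitaryGroup n ℂ}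
  have hcont : Continuous fun U : Matrix n n ℂ => conjugation (bilateral U) X := by
    have h : Continuous fun U : Matrix n n ℂ => bilateral U := by
      refine continuous_matrix fun i j => ?_
      change Continuous fun U : Matrix n n ℂ => U i.1 j.1 * star (U i.2 j.2)
      fun_prop
    simp only [conjugation_apply]
    fun_prop
  have hK : IsCompact (convexHull ℝ orbit) :=
    isCompact_convexHull_of_isCompact (isCompact_unitaryGroup.image hcont)
  have hne : (convexHull ℝ orbit).Nonempty :=
    Set.Nonempty.convexHull ⟨_, ⟨1, one_mem (Matrix.unitaryGroup n ℂ), rfl⟩⟩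
  have hfc : Continuous (frobSq (S := n × n)) := by
    unfold frobSq
    exact Complex.continuous_re.comp (Continuous.matrix_trace (by fun_prop))
  obtain ⟨Y, hY, hmin⟩ := hK.exists_isMinOn hne hfc.continuousOn
  have hinv : ∀ U ∈ Matrix.unitaryGroup n ℂ, conjugation (bilateral U) Y = Y := by
    intro U hU
    have h1 : conjugation (bilateral U) Y ∈ convexHull ℝ orbit := by
      have h2 : ((conjugation (bilateral U)).restrictScalars ℝ) Y ∈
          ((conjugation (bilateral U)).restrictScalars ℝ) '' convexHull ℝ orbit := ⟨Y, hY, rfl⟩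
      rw [LinearMap.image_convexHull] at h2
      refine convexHull_mono ?_ h2
      rintro _ ⟨_, ⟨V, hV, rfl⟩, rfl⟩
      refine ⟨U * V, mul_mem hU hV, ?_⟩
      simp only [bilateral_mul, conjugation_mul, LinearMap.restrictScalars_apply]
    -- `Y` and its conjugate have the same norm, so minimality at their midpoint forces them to
    -- coincide.
    have h3 := hmin ((convex_convexHull ℝ orbit) h1 hY (by norm_num : (0 : ℝ) ≤ 1 / 2)
      (by norm_num : (0 : ℝ) ≤ 1 / 2) (by norm_num))
    simp only [Set.mem_ofPred_eq, frobSq_midpoint,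
      frobSq_conjugation (bilateral_mem_unitaryGroup hU)] at h3
    exact eq_of_frobSq_sub_nonpos (by linarith)
  -- Evaluation at `X` is linear, so a point of the hull of the orbit is the value at `X` of one
  -- mixture of conjugations.
  let ev : LinOp (n × n) (n × n) →ₗ[ℝ] Matrix (n × n) (n × n) ℂ :=
    { toFun := fun T => T X, map_add' := fun _ _ => rfl, map_smul' := fun _ _ => rfl }
  have hev : convexHull ℝ orbit = ev '' convexHull ℝ (bilateralConjugations n) := by
    rw [LinearMap.image_convexHull]
    congr 1
    ext Z
    constructor
    · rintro ⟨U, hU, rfl⟩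
      exact ⟨_, ⟨U, hU, rfl⟩, rfl⟩
    · rintro ⟨_, ⟨U, hU, rfl⟩, rfl⟩
      exact ⟨U, hU, rfl⟩
  rw [hev] at hY
  obtain ⟨T, hT, rfl⟩ := hY
  exact ⟨T, hT, hinv⟩

/-! ### Operators commuting with bilateral unitaries -/

omit [DecidableEq n] in
lemma bilateral_mul_apply (U : Matrix n n ℂ) (X : Matrix (n × n) (n × n) ℂ) (i j : n)
    (q : n × n) :
    (bilateral U * X) (i, j) q = ∑ a, ∑ b, U i a * star (U j b) * X (a, b) q := by
  simp [bilateral, Matrix.mul_apply, Fintype.sum_prod_type]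

omit [DecidableEq n] in
lemma mul_bilateral_apply (U : Matrix n n ℂ) (X : Matrix (n × n) (n × n) ℂ) (p : n × n)
    (k l : n) :
    (X * bilateral U) p (k, l) = ∑ a, ∑ b, X p (a, b) * (U a k * star (U b l)) := by
  simp [bilateral, Matrix.mul_apply, Fintype.sum_prod_type]

/-- A permutation matrix is real, so its bilateral version permutes both tensor factors in the same
way. -/
lemma apply_eq_of_commute_perm {X : Matrix (n × n) (n × n) ℂ}
    (hX : ∀ U ∈ Matrix.unitaryGroup n ℂ, bilateral U * X = X * bilateral U)
    (σ : Equiv.Perm n) (i j k l : n) : X (σ i, σ j) (σ k, σ l) = X (i, j) (k, l) := by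
  let U : Matrix n n ℂ := Matrix.of fun a b => if σ a = b then 1 else 0
  have hU : U ∈ Matrix.unitaryGroup n ℂ := by
    rw [Matrix.mem_unitaryGroup_iff]
    ext a b
    simp [U, Matrix.mul_apply, Matrix.star_apply, Matrix.one_apply, eq_comm]
  have h := congrFun (congrFun (hX U hU) (i, j)) (σ k, σ l)
  rw [bilateral_mul_apply, mul_bilateral_apply] at h
  simpa [U] using h

omit [Fintype n] in
lemma bilateral_diagonal (u : n → ℂ) :
    bilateral (Matrix.diagonal u) = Matrix.diagonal fun p => u p.1 * star (u p.2) := by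
  rw [bilateral, Matrix.diagonal_map (star_zero ℂ), Matrix.diagonal_kronecker_diagonal]

/-- A nonzero entry forces the phases `u i * star (u j)` and `u k * star (u l)` to agree for every
diagonal unitary. One phase `I` at a single site suffices; `-1` would not, since the entry `(i, j),
(j, i)` compares a phase with its conjugate. -/
lemma apply_eq_zero_of_commute_diagonal {X : Matrix (n × n) (n × n) ℂ}
    (hX : ∀ U ∈ Matrix.unitaryGroup n ℂ, bilateral U * X = X * bilateral U)
    {i j k l : n} (h1 : ¬ (i = j ∧ k = l)) (h2 : ¬ (i = k ∧ j = l)) : X (i, j) (k, l) = 0 := by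
  have key : ∀ c : n, X (i, j) (k, l) ≠ 0 →
      (if i = c then Complex.I else 1) * star (if j = c then Complex.I else 1) =
      (if k = c then Complex.I else 1) * star (if l = c then Complex.I else 1) := by
    intro c hne
    let U : Matrix n n ℂ := Matrix.diagonal fun a => if a = c then Complex.I else 1
    have hU : U ∈ Matrix.unitaryGroup n ℂ := by
      rw [Matrix.mem_unitaryGroup_iff, Matrix.star_eq_conjTranspose, Matrix.diagonal_conjTranspose,
        Matrix.diagonal_mul_diagonal, ← Matrix.diagonal_one]
      congr 1
      ext a
      simp only [Pi.star_apply]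
      split_ifs <;> simp
    have h := congrFun (congrFun (hX U hU) (i, j)) (k, l)
    rw [bilateral_diagonal, Matrix.diagonal_mul, Matrix.mul_diagonal] at h
    exact mul_left_cancel₀ hne ((mul_comm _ _).trans h)
  by_contra hne
  have hI1 : Complex.I ≠ 1 := fun h => by simpa using congrArg Complex.re h
  have hI2 : Complex.I ≠ -Complex.I := fun h => by
    have := congrArg Complex.im h
    norm_num at this
  have hI3 : -Complex.I ≠ 1 := fun h => by simpa using congrArg Complex.re h
  by_cases e1 : i = j
  · subst e1
    have e2 : ¬ l = k := fun h => h1 ⟨rfl, h.symm⟩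
    have := key k hne
    by_cases e3 : i = k <;> simp [e2, e3, hI1.symm] at this
  · by_cases e3 : i = k
    · subst e3
      have e4 : ¬ l = j := fun h => h2 ⟨rfl, h.symm⟩
      have := key j hne
      simp [e1, e4, hI3] at this
    · have := key i hne
      by_cases e4 : l = i <;> simp [Ne.symm e1, Ne.symm e3, e4, hI1, hI2] at this

omit [Fintype n] in
lemma exists_perm_apply_pair {i j k l : n} (hij : i ≠ j) (hkl : k ≠ l) :
    ∃ σ : Equiv.Perm n, σ i = k ∧ σ j = l := by
  refine ⟨Equiv.swap (Equiv.swap i k j) l * Equiv.swap i k, ?_, by simp⟩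
  rw [Equiv.Perm.mul_apply, Equiv.swap_apply_left, Equiv.swap_apply_of_ne_of_ne _ hkl]
  intro h
  exact hij ((Equiv.swap i k).injective (by rw [Equiv.swap_apply_left, ← h]))

lemma bilateral_mul_maxEntangled {U : Matrix n n ℂ} (hU : U ∈ Matrix.unitaryGroup n ℂ) :
    bilateral U * maxEntangled n = maxEntangled n := by
  have h1 : ∀ i j, ∑ a, U i a * star (U j a) = if i = j then 1 else 0 := fun i j => by
    have := congrFun (congrFun (Matrix.mem_unitaryGroup_iff.1 hU) i) j
    simpa [Matrix.mul_apply, Matrix.star_apply, Matrix.one_apply] using this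
  ext ⟨i, j⟩ ⟨k, l⟩
  rw [bilateral_mul_apply]
  by_cases hkl : k = l
  · simp only [maxEntangled, Matrix.of_apply, hkl, and_true, mul_ite, mul_zero,
      Finset.sum_ite_eq, Finset.mem_univ, if_true, ← Finset.sum_mul, h1]
    simp
  · simp [maxEntangled, hkl]

lemma maxEntangled_eq_vecMulVec : maxEntangled n =
    (Fintype.card n : ℝ)⁻¹ • Matrix.vecMulVec (fun p : n × n => if p.1 = p.2 then (1 : ℂ) else 0)
      (star fun p : n × n => if p.1 = p.2 then (1 : ℂ) else 0) := by
  ext p q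
  by_cases h1 : p.1 = p.2 <;> by_cases h2 : q.1 = q.2 <;>
    simp [maxEntangled, Matrix.vecMulVec_apply, h1, h2]

lemma posSemidef_maxEntangled : (maxEntangled n).PosSemidef := by
  rw [maxEntangled_eq_vecMulVec]
  exact (Matrix.posSemidef_vecMulVec_self_star _).smul (by positivity)

lemma maxEntangled_mul_bilateral {U : Matrix n n ℂ} (hU : U ∈ Matrix.unitaryGroup n ℂ) :
    maxEntangled n * bilateral U = maxEntangled n := by
  have h1 : (bilateral U)ᴴ * bilateral U = 1 :=
    Matrix.mem_unitaryGroup_iff'.1 (bilateral_mem_unitaryGroup hU)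
  have h2 := congrArg Matrix.conjTranspose (bilateral_mul_maxEntangled hU)
  rw [Matrix.conjTranspose_mul, posSemidef_maxEntangled.isHermitian.eq] at h2
  conv_lhs => rw [← h2, Matrix.mul_assoc, h1, Matrix.mul_one]

lemma trace_maxEntangled [Nonempty n] : (maxEntangled n).trace = 1 := by
  simp [maxEntangled, Matrix.trace, Fintype.sum_prod_type]

lemma maxEntangled_mul_self [Nonempty n] : maxEntangled n * maxEntangled n = maxEntangled n := by
  ext ⟨i, j⟩ ⟨k, l⟩
  rw [Matrix.mul_apply, Fintype.sum_prod_type]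
  by_cases h1 : i = j <;> by_cases h2 : k = l <;> simp [maxEntangled, h1, h2]

lemma posSemidef_one_sub_maxEntangled [Nonempty n] : (1 - maxEntangled n).PosSemidef := by
  have h1 : (1 - maxEntangled n)ᴴ = 1 - maxEntangled n := by
    rw [Matrix.conjTranspose_sub, Matrix.conjTranspose_one, posSemidef_maxEntangled.isHermitian.eq]
  have h2 : (1 - maxEntangled n)ᴴ * (1 - maxEntangled n) = 1 - maxEntangled n := by
    rw [h1, Matrix.mul_sub, Matrix.sub_mul _ _ (maxEntangled n), maxEntangled_mul_self]; simp
  rw [← h2]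
  exact Matrix.posSemidef_conjTranspose_mul_self _

/-- Operators commuting with all bilateral unitaries are isotropic. -/
lemma exists_eq_isotropic_of_commute [Nontrivial n] {X : Matrix (n × n) (n × n) ℂ}
    (hX : ∀ U ∈ Matrix.unitaryGroup n ℂ, bilateral U * X = X * bilateral U) :
    ∃ a b : ℂ, X = a • (1 : Matrix (n × n) (n × n) ℂ) + b • maxEntangled n := by
  obtain ⟨e, f, hef⟩ := exists_pair_ne n
  let D : Matrix (n × n) (n × n) ℂ := Matrix.diagonal fun p => if p.1 = p.2 then 1 else 0
  have hcard : (Fintype.card n : ℂ) ≠ 0 := Nat.cast_ne_zero.2 Fintype.card_ne_zero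
  obtain ⟨b, hb⟩ : ∃ b, ∀ i j, i ≠ j → X (i, j) (i, j) = b := by
    refine ⟨X (e, f) (e, f), fun i j hij => ?_⟩
    obtain ⟨σ, rfl, rfl⟩ := exists_perm_apply_pair hef hij
    exact apply_eq_of_commute_perm hX σ _ _ _ _
  obtain ⟨c, hc⟩ : ∃ c, ∀ i j, i ≠ j → X (i, i) (j, j) = c := by
    refine ⟨X (e, e) (f, f), fun i j hij => ?_⟩
    obtain ⟨σ, rfl, rfl⟩ := exists_perm_apply_pair hef hij
    exact apply_eq_of_commute_perm hX σ _ _ _ _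
  obtain ⟨a, ha⟩ : ∃ a, ∀ i, X (i, i) (i, i) = a := by
    refine ⟨X (e, e) (e, e), fun i => ?_⟩
    have := apply_eq_of_commute_perm hX (Equiv.swap e i) e e e e
    rwa [Equiv.swap_apply_left] at this
  -- Permutations and diagonal unitaries leave three parameters; the extra term `D` must be excluded
  -- by another unitary.
  have hdec : X = b • (1 : Matrix (n × n) (n × n) ℂ) + (c * Fintype.card n) • maxEntangled n +
      (a - b - c) • D := by
    ext ⟨i, j⟩ ⟨k, l⟩
    simp only [Matrix.add_apply, Matrix.smul_apply, Matrix.one_apply, maxEntangled,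
      Matrix.of_apply, D, Matrix.diagonal_apply, Prod.mk.injEq, smul_eq_mul]
    by_cases h1 : i = j ∧ k = l
    · obtain ⟨rfl, rfl⟩ := h1
      by_cases h2 : i = k
      · subst h2
        rw [ha]
        simp [hcard]
      · rw [hc i k h2]
        simp [hcard, h2]
    · by_cases h2 : i = k ∧ j = l
      · obtain ⟨rfl, rfl⟩ := h2
        have h3 : i ≠ j := fun h => h1 ⟨h, h⟩
        rw [hb i j h3]
        simp [h3]
      · rw [apply_eq_zero_of_commute_diagonal hX h1 h2]
        simp [h1, h2]
  suffices h : a - b - c = 0 by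
    rw [h, zero_smul, add_zero] at hdec
    exact ⟨_, _, hdec⟩
  let P : Matrix n n ℂ := Matrix.of fun x y => if Equiv.swap e f x = y then 1 else 0
  have hPP : P * P = 1 := by
    ext x y
    simp only [P, Matrix.mul_apply, Matrix.of_apply, ite_mul, one_mul, zero_mul, Finset.sum_ite_eq,
      Finset.mem_univ, if_true]
    simp [Matrix.one_apply]
  have hPs : Pᴴ = P := by
    ext x y
    simp only [P, Matrix.conjTranspose_apply, Matrix.of_apply]
    have : Equiv.swap e f y = x ↔ Equiv.swap e f x = y := by
      rw [Equiv.swap_apply_eq_iff, eq_comm]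
    simp only [this]
    split_ifs <;> simp
  -- Unitary because `P` is a Hermitian involution and `3, 4, 5` is a Pythagorean triple. It mixes
  -- `e` and `f`, so `bilateral U` has a nonzero entry at `(e, f), (e, e)`, which commuting with `D`
  -- would forbid.
  let U : Matrix n n ℂ := (3 / 5 : ℂ) • (1 : Matrix n n ℂ) + (4 / 5 * Complex.I) • P
  have hU : U ∈ Matrix.unitaryGroup n ℂ := by
    rw [Matrix.mem_unitaryGroup_iff, Matrix.star_eq_conjTranspose]
    simp only [U, Matrix.conjTranspose_add, Matrix.conjTranspose_smul, hPs,
      Matrix.conjTranspose_one, Matrix.add_mul, Matrix.mul_add, Matrix.smul_mul, Matrix.mul_smul, hPP,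
      Matrix.one_mul, Matrix.mul_one]
    ext x y
    simp only [Matrix.add_apply, Matrix.smul_apply, smul_eq_mul, star_mul', star_div₀,
      Complex.star_def, Complex.conj_I, map_ofNat]
    linear_combination (-16 / 25 * (1 : Matrix n n ℂ) x y) * Complex.I_sq
  have h1 := hX U hU
  rw [hdec] at h1
  simp only [Matrix.add_mul, Matrix.mul_add, Matrix.smul_mul, Matrix.mul_smul, Matrix.one_mul,
    Matrix.mul_one, bilateral_mul_maxEntangled hU, maxEntangled_mul_bilateral hU,
    add_right_inj] at h1
  have h2 := congrFun (congrFun h1 (e, f)) (e, e)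
  simp only [Matrix.smul_apply, D, Matrix.diagonal_mul, Matrix.mul_diagonal, if_neg hef,
    if_true, mul_one, zero_mul, smul_eq_mul, mul_zero] at h2
  refine (mul_eq_zero.1 h2).resolve_right ?_
  simp [bilateral, U, P, hef.symm]

end Twirl

/-! ### Isotropic states and virtual decompositions of the maximally entangled state -/

section Isotropic

variable {n : Type} [Fintype n] [DecidableEq n]

/-- Each bilateral conjugation preserves both quantities, and mixing keeps them. Together they
determine an isotropic operator, which identifies the output of the twirl. -/
lemma trace_apply_of_mem_convexHull_bilateral {T : LinOp (n × n) (n × n)}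
    (hT : T ∈ convexHull ℝ (bilateralConjugations n)) (X : Matrix (n × n) (n × n) ℂ) :
    (T X).trace = X.trace ∧ (T X * maxEntangled n).trace = (X * maxEntangled n).trace := by
  have hconv : Convex ℝ {T : LinOp (n × n) (n × n) | (T X).trace = X.trace ∧
      (T X * maxEntangled n).trace = (X * maxEntangled n).trace} := by
    rintro T₁ ⟨h₁, h₁'⟩ T₂ ⟨h₂, h₂'⟩ a b - - hab
    constructor
    · rw [LinearMap.add_apply, LinearMap.smul_apply, LinearMap.smul_apply, Matrix.trace_add,
        Matrix.trace_smul, Matrix.trace_smul, h₁, h₂, ← add_smul, hab, one_smul]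
    · rw [LinearMap.add_apply, LinearMap.smul_apply, LinearMap.smul_apply, Matrix.add_mul,
        Matrix.smul_mul, Matrix.smul_mul, Matrix.trace_add,
        Matrix.trace_smul, Matrix.trace_smul, h₁', h₂', ← add_smul, hab, one_smul]
  refine convexHull_min ?_ hconv hT
  rintro _ ⟨U, hU, rfl⟩
  have hW : (bilateral U)ᴴ * bilateral U = 1 :=
    Matrix.mem_unitaryGroup_iff'.1 (bilateral_mem_unitaryGroup hU)
  have hP : (bilateral U)ᴴ * maxEntangled n = maxEntangled n := by
    have h := congrArg Matrix.conjTranspose (maxEntangled_mul_bilateral hU)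
    rwa [Matrix.conjTranspose_mul, posSemidef_maxEntangled.isHermitian.eq] at h
  constructor
  · rw [conjugation_apply, Matrix.trace_mul_comm, Matrix.mul_assoc, hW, Matrix.mul_one]
  · rw [conjugation_apply, Matrix.mul_assoc, Matrix.mul_assoc, hP, Matrix.trace_mul_comm,
      Matrix.mul_assoc, maxEntangled_mul_bilateral hU]

omit [DecidableEq n] in
lemma card_sq_sub_one_pos [Nontrivial n] : (0 : ℝ) < (Fintype.card n : ℝ) ^ 2 - 1 := by
  have : (1 : ℝ) < Fintype.card n := by exact_mod_cast Fintype.one_lt_card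
  nlinarith

lemma isState_maxEntangled [Nonempty n] : IsState (maxEntangled n) :=
  ⟨posSemidef_maxEntangled, trace_maxEntangled⟩

lemma isState_complementState [Nontrivial n] : IsState (complementState n) := by
  have h := card_sq_sub_one_pos (n := n)
  refine ⟨posSemidef_one_sub_maxEntangled.smul (inv_nonneg.2 h.le), ?_⟩
  rw [complementState, Matrix.trace_smul, Matrix.trace_sub, trace_maxEntangled, Matrix.trace_one,
    Fintype.card_prod, Complex.real_smul]
  have h' : (((Fintype.card n : ℝ) ^ 2 - 1 : ℝ) : ℂ) ≠ 0 := Complex.ofReal_ne_zero.2 h.ne'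
  push_cast at h' ⊢
  rw [← pow_two]
  exact inv_mul_cancel₀ h'

/-- Every operator can be brought into isotropic form by a random local unitary operation. -/
lemma exists_twirl [Nontrivial n] (X : Matrix (n × n) (n × n) ℂ) :
    ∃ T : LinOp (n × n) (n × n), IsRandomLocalUnitary T ∧
      T X = (X * maxEntangled n).trace • maxEntangled n +
        (X.trace - (X * maxEntangled n).trace) • complementState n := by
  obtain ⟨T, hT, hinv⟩ := exists_bilateral_invariant X
  obtain ⟨a, b, hab⟩ := exists_eq_isotropic_of_commute fun U hU =>
    (conjugation_eq_self_iff (bilateral_mem_unitaryGroup hU) _).1 (hinv U hU)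
  refine ⟨T, isRandomLocalUnitary_of_mem hT, ?_⟩
  obtain ⟨h1, h2⟩ := trace_apply_of_mem_convexHull_bilateral hT X
  rw [← h1, ← h2, hab]
  have h' : ((Fintype.card n : ℂ) ^ 2 - 1) ≠ 0 := by
    have := Complex.ofReal_ne_zero.2 (card_sq_sub_one_pos (n := n)).ne'
    push_cast at this
    exact this
  simp only [Matrix.add_mul, Matrix.smul_mul, Matrix.one_mul, maxEntangled_mul_self,
    Matrix.trace_add, Matrix.trace_smul, trace_maxEntangled, Matrix.trace_one, Fintype.card_prod,
    complementState]
  ext p q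
  simp only [Matrix.add_apply, Matrix.smul_apply, Matrix.sub_apply, smul_eq_mul,
    Complex.real_smul]
  push_cast
  field_simp
  ring

lemma isState_single (i : n) : IsState (Matrix.single i i (1 : ℂ)) := by
  refine ⟨?_, by simp⟩
  rw [← Matrix.diagonal_single, Matrix.posSemidef_diagonal_iff]
  intro j
  by_cases h : i = j
  · subst h; simp
  · simp [Ne.symm h]

lemma isSeparable_single (i j : n) :
    IsSeparable (Matrix.single i i (1 : ℂ) ⊗ₖ Matrix.single j j (1 : ℂ)) :=
  subset_convexHull ℝ _ ⟨_, _, isState_single i, isState_single j, rfl⟩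

lemma trace_single_mul_maxEntangled (i j : n) :
    ((Matrix.single i i (1 : ℂ) ⊗ₖ Matrix.single j j (1 : ℂ)) * maxEntangled n).trace =
      if i = j then (Fintype.card n : ℂ)⁻¹ else 0 := by
  rw [Matrix.single_kronecker_single, Matrix.trace_single_mul]
  simp [maxEntangled]

/-- A product basis state with `i ≠ j` has zero overlap with `maxEntangled n`, so its twirl is
exactly `complementState n`. -/
lemma isSeparable_complementState [Nontrivial n]
    (h : ∀ T : LinOp (n × n) (n × n), IsRandomLocalUnitary T →
      ∀ σ, IsSeparable σ → IsSeparable (T σ)) : IsSeparable (complementState n) := by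
  obtain ⟨i, j, hij⟩ := exists_pair_ne n
  obtain ⟨T, hT, hTX⟩ := exists_twirl (Matrix.single i i (1 : ℂ) ⊗ₖ Matrix.single j j (1 : ℂ))
  have := h T hT _ (isSeparable_single i j)
  rw [hTX, trace_single_mul_maxEntangled, if_neg hij, Matrix.trace_kronecker,
    Matrix.trace_single_eq_same, Matrix.trace_single_eq_same] at this
  simpa using this

lemma trace_mul_nonneg_of_isIdempotent {S : Type} [Fintype S] {X Q : Matrix S S ℂ}
    (hX : X.PosSemidef) (hQ : Qᴴ = Q) (hQQ : Q * Q = Q) : 0 ≤ (X * Q).trace := by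
  have h := (hX.mul_mul_conjTranspose_same Q).trace_nonneg
  rwa [hQ, Matrix.mul_assoc, Matrix.trace_mul_comm, Matrix.mul_assoc, hQQ] at h

lemma trace_mul_maxEntangled_nonneg [Nonempty n] {X : Matrix (n × n) (n × n) ℂ}
    (hX : IsState X) : 0 ≤ (X * maxEntangled n).trace :=
  trace_mul_nonneg_of_isIdempotent hX.1 posSemidef_maxEntangled.isHermitian maxEntangled_mul_self

lemma re_trace_mul_maxEntangled_le_one [Nonempty n] {X : Matrix (n × n) (n × n) ℂ}
    (hX : IsState X) : (X * maxEntangled n).trace.re ≤ 1 := by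
  have h := trace_mul_nonneg_of_isIdempotent (Q := 1 - maxEntangled n) hX.1
    posSemidef_one_sub_maxEntangled.isHermitian (by
      rw [Matrix.mul_sub, Matrix.sub_mul _ _ (maxEntangled n), maxEntangled_mul_self]; simp)
  rw [Matrix.mul_sub, Matrix.mul_one, Matrix.trace_sub, hX.2] at h
  simpa using (Complex.nonneg_iff.1 h).1

/-- The overlap attained by one state of an approximate virtual decomposition of the maximally
entangled state. -/
lemma le_mul_overlap_of_traceNorm_le [Nonempty n] {σp σm : Matrix (n × n) (n × n) ℂ}
    (hp : IsState σp) (hm : IsState σm) {lp lm ε : ℝ} (hlm : 0 ≤ lm) (hl : lp - lm = 1)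
    (h : (1 / 2 : ℝ) * traceNorm (maxEntangled n - (lp • σp - lm • σm)) ≤ ε) :
    1 - ε ≤ lp * (σp * maxEntangled n).trace.re := by
  have hsmul : ∀ (r : ℝ) {σ : Matrix (n × n) (n × n) ℂ}, IsState σ → (r • σ)ᴴ = r • σ :=
    fun r σ hσ => by rw [Matrix.conjTranspose_smul, hσ.1.isHermitian.eq, star_trivial]
  have hherm : (maxEntangled n - (lp • σp - lm • σm)).IsHermitian := by
    rw [Matrix.IsHermitian, Matrix.conjTranspose_sub, Matrix.conjTranspose_sub, hsmul lp hp,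
      hsmul lm hm, posSemidef_maxEntangled.isHermitian.eq]
  have htr : (maxEntangled n - (lp • σp - lm • σm)).trace = 0 := by
    rw [Matrix.trace_sub, Matrix.trace_sub, Matrix.trace_smul, Matrix.trace_smul, hp.2, hm.2,
      trace_maxEntangled, ← sub_smul, hl, one_smul, sub_self]
  have h1 := (re_trace_mul_le_half_traceNorm hherm htr posSemidef_maxEntangled
    posSemidef_one_sub_maxEntangled).trans h
  simp only [Matrix.sub_mul, Matrix.smul_mul, maxEntangled_mul_self, Matrix.trace_sub,
    Matrix.trace_smul, trace_maxEntangled, Complex.sub_re, Complex.one_re, Complex.smul_re,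
    smul_eq_mul] at h1
  -- The subtracted state can only lower the overlap, so its term may be dropped.
  have h2 := mul_nonneg hlm (Complex.nonneg_iff.1 (trace_mul_maxEntangled_nonneg hm)).1
  linarith

/-- The error of the explicit decomposition: the complement parts combine to weight `1 - lp * F`,
leaving a multiple of a difference of two states. -/
lemma half_traceNorm_isotropic_le [Nontrivial n] {F lp lm : ℝ} (hl : lp - lm = 1) :
    (1 / 2 : ℝ) * traceNorm (maxEntangled n - (lp • ((F : ℂ) • maxEntangled n +
      (1 - (F : ℂ)) • complementState n) - lm • complementState n)) ≤ |1 - lp * F| := by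
  have heq : maxEntangled n - (lp • ((F : ℂ) • maxEntangled n +
      (1 - (F : ℂ)) • complementState n) - lm • complementState n) =
      (1 - lp * F) • (maxEntangled n - complementState n) := by
    obtain rfl : lm = lp - 1 := by linarith
    ext p q
    simp only [Matrix.add_apply, Matrix.smul_apply, Matrix.sub_apply, smul_eq_mul,
      Complex.real_smul]
    push_cast
    ring
  have := traceNorm_smul_sub_le (isState_maxEntangled (n := n)) isState_complementState
    (1 - lp * F)
  rw [heq]
  linarith

end Isotropic

/-! ### The target state and the class of free operations -/

lemma bellPower_eq_maxEntangled (m : ℕ) : bellPower m = maxEntangled (Qubits m) := by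
  have hb : ∀ a b c d : Fin 2, bellState (a, b) (c, d) = if a = b ∧ c = d then 2⁻¹ else 0 := by
    intro a b c d
    have h2 : ((Real.sqrt 2 : ℝ) : ℂ)⁻¹ * ((Real.sqrt 2 : ℝ) : ℂ)⁻¹ = 2⁻¹ := by
      rw [← mul_inv, ← Complex.ofReal_mul, Real.mul_self_sqrt (by norm_num)]
      norm_num
    by_cases h1 : a = b <;> by_cases h3 : c = d <;>
      simp [bellState, bellKet, Matrix.vecMulVec_apply, h1, h3, h2]
  ext p q
  simp only [bellPower, maxEntangled, Matrix.of_apply, hb]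
  by_cases h : p.1 = p.2 ∧ q.1 = q.2
  · simp [h.1, h.2]
  · rw [if_neg h]
    obtain ⟨i, hi⟩ : ∃ i, ¬ (p.1 i = p.2 i ∧ q.1 i = q.2 i) := by
      by_contra! hcon
      exact h ⟨funext fun i => (hcon i).1, funext fun i => (hcon i).2⟩
    exact Finset.prod_eq_zero (Finset.mem_univ i) (if_neg hi)

lemma IsChannel.isState {S T : Type} [Fintype S] [Fintype T] {Λ : LinOp S T} (h : IsChannel Λ)
    {ρ : Matrix S S ℂ} (hρ : IsState ρ) : IsState (Λ ρ) :=
  ⟨h.1.posSemidef hρ.1, (h.2 ρ).trans hρ.2⟩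

end VirtualDistillation

end

/-! ### The overhead formula and attainment of the singlet fraction -/

open VirtualDistillation

theorem mainTheorem8
    (O : VirtualDistillation.OperationClass)
    -- every operation in `O` is separability-preserving
    (hsep : ∀ (A B A' B' : Type) [Fintype A] [Fintype B] [Fintype A'] [Fintype B'],
      ∀ Λ ∈ O A B A' B', VirtualDistillation.IsSeparabilityPreserving Λ)
    -- `O` contains the local unitary operations assisted by shared randomness
    (hlu : ∀ (A B : Type) [Fintype A] [DecidableEq A] [Fintype B] [DecidableEq B]
      (T : VirtualDistillation.LinOp (A × B) (A × B)),
      VirtualDistillation.IsRandomLocalUnitary T → T ∈ O A B A B)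
    -- an operation in `O` may be followed by such a random local unitary operation
    (hcomp : ∀ (A B A' B' : Type) [Fintype A] [Fintype B]
      [Fintype A'] [DecidableEq A'] [Fintype B'] [DecidableEq B'],
      ∀ Λ ∈ O A B A' B', ∀ T ∈ O A' B' A' B',
        VirtualDistillation.IsRandomLocalUnitary T → T ∘ₗ Λ ∈ O A B A' B')
    -- separable states can be prepared for free
    (hprep : ∀ (A B A' B' : Type) [Fintype A] [Fintype B] [Fintype A'] [Fintype B']
      (σ : Matrix (A' × B') (A' × B') ℂ), VirtualDistillation.IsSeparable σ →
        VirtualDistillation.preparation (A × B) σ ∈ O A B A' B')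
    (A B : Type) [Fintype A] [Fintype B]
    (ρ : Matrix (A × B) (A × B) ℂ) (hρ : VirtualDistillation.IsState ρ)
    (m : ℕ) (hm : 1 ≤ m) (ε : ℝ) (hε0 : 0 ≤ ε) (hε1 : ε ≤ 1) :
    0 < VirtualDistillation.singletFraction O ρ m ∧
    VirtualDistillation.virtualOverhead O ε ρ m =
      ((max (2 * (1 - ε) / VirtualDistillation.singletFraction O ρ m - 1) 1 : ℝ) : EReal) ∧
    -- the singlet fraction is a maximum when the set of available operations is closed
    (IsClosed {g : Matrix (A × B) (A × B) ℂ → Matrix (VirtualDistillation.Qubits m ×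
          VirtualDistillation.Qubits m) (VirtualDistillation.Qubits m ×
          VirtualDistillation.Qubits m) ℂ |
        ∃ Λ ∈ O A B (VirtualDistillation.Qubits m) (VirtualDistillation.Qubits m), g = ⇑Λ} →
      ∃ Λ ∈ O A B (VirtualDistillation.Qubits m) (VirtualDistillation.Qubits m),
        (Λ ρ * VirtualDistillation.bellPower m).trace.re =
          VirtualDistillation.singletFraction O ρ m) := by
  classical
  -- Makes `Qubits m` nontrivial, so that `d ^ 2 - 1` is positive.
  have : Nonempty (Fin m) := ⟨⟨0, hm⟩⟩
  let P := maxEntangled (Qubits m)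
  let R := complementState (Qubits m)
  let S : Set ℝ := {t : ℝ | ∃ Λ ∈ O A B (Qubits m) (Qubits m), t = (Λ ρ * bellPower m).trace.re}
  set f := singletFraction O ρ m with hf
  have hstate : ∀ Λ ∈ O A B (Qubits m) (Qubits m), IsState (Λ ρ) := fun Λ hΛ =>
    (hsep A B _ _ Λ hΛ).1.isState hρ
  have hbdd : BddAbove S := by
    refine ⟨1, ?_⟩
    rintro _ ⟨Λ, hΛ, rfl⟩
    rw [bellPower_eq_maxEntangled]
    exact re_trace_mul_maxEntangled_le_one (hstate Λ hΛ)
  have hle : ∀ Λ ∈ O A B (Qubits m) (Qubits m), (Λ ρ * P).trace.re ≤ f := fun Λ hΛ =>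
    le_csSup hbdd ⟨Λ, hΛ, by rw [bellPower_eq_maxEntangled]⟩
  -- Preparing a product state `|ii⟩` already achieves overlap `1 / d`, whence positivity of `f`.
  have hfree : ∀ i : Qubits m, ∃ Λ ∈ O A B (Qubits m) (Qubits m),
      (Λ ρ * P).trace.re = (Fintype.card (Qubits m) : ℝ)⁻¹ := fun i => by
    refine ⟨_, hprep A B _ _ _ (isSeparable_single i i), ?_⟩
    have : preparation (A × B) (Matrix.single i i (1 : ℂ) ⊗ₖ Matrix.single i i (1 : ℂ)) ρ =
        Matrix.single i i (1 : ℂ) ⊗ₖ Matrix.single i i (1 : ℂ) := by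
      simp [preparation, hρ.2]
    rw [this, trace_single_mul_maxEntangled, if_pos rfl, ← Complex.ofReal_natCast,
      ← Complex.ofReal_inv, Complex.ofReal_re]
  obtain ⟨Λ₀, hΛ₀, hΛ₀P⟩ := hfree 0
  have hne : S.Nonempty := ⟨_, Λ₀, hΛ₀, rfl⟩
  have hfpos : 0 < f := by
    have h1 : (0 : ℝ) < (Fintype.card (Qubits m) : ℝ)⁻¹ := by positivity
    exact h1.trans_le (hΛ₀P ▸ hle Λ₀ hΛ₀)
  refine ⟨hfpos, ?_, ?_⟩
  · apply le_antisymm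
    -- The supremum `f` need not be attained, so every real `c` strictly above the claimed value is
    -- shown to bound the overhead.
    · refine EReal.le_of_forall_lt_iff_le.1 fun c hc => ?_
      rw [EReal.coe_lt_coe_iff, max_lt_iff] at hc
      have h1 : 2 * (1 - ε) / (c + 1) < f := by
        rw [div_lt_iff₀ (by linarith)]
        have := (div_lt_iff₀ hfpos).1 (by linarith [hc.1] : 2 * (1 - ε) / f < c + 1)
        linarith
      obtain ⟨_, ⟨Λ, hΛ, rfl⟩, hF⟩ := exists_lt_of_lt_csSup hne h1
      rw [bellPower_eq_maxEntangled] at hF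
      set F := (Λ ρ * maxEntangled (Qubits m)).trace.re with hFdef
      have hF0 : 0 < F := lt_of_le_of_lt (div_nonneg (by linarith) (by linarith)) hF
      have hF1 : F ≤ 1 := re_trace_mul_maxEntangled_le_one (hstate Λ hΛ)
      have hFc : (Λ ρ * maxEntangled (Qubits m)).trace = (F : ℂ) :=
        Complex.ext rfl (Complex.nonneg_iff.1 (trace_mul_maxEntangled_nonneg (hstate Λ hΛ))).2.symm
      obtain ⟨T, hT, hTX⟩ := exists_twirl (Λ ρ)
      rw [hFc, (hstate Λ hΛ).2] at hTX
      have hRsep : IsSeparable R := isSeparable_complementState fun T hT σ hσ =>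
        (hsep _ _ _ _ T (hlu _ _ T hT)).2 σ hσ
      -- The maximum with `1` keeps `lp - 1` nonnegative, while `lp * F = max (1 - ε) F` stays in
      -- `[1 - ε, 1]`.
      let lp := max ((1 - ε) / F) 1
      have hlpF : lp * F = max (1 - ε) F := by
        rw [max_mul_of_nonneg _ _ hF0.le, div_mul_cancel₀ _ hF0.ne', one_mul]
      have hlp1 : 1 ≤ lp := le_max_right _ _
      have hprepR : preparation (A × B) R ρ = R := by simp [preparation, hρ.2]
      refine le_trans (b := ((lp + (lp - 1) : ℝ) : EReal)) (sInf_le ⟨lp, lp - 1, T ∘ₗ Λ, preparation (A × B) R,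
        hcomp _ _ _ _ Λ hΛ T (hlu _ _ T hT) hT, hprep _ _ _ _ R hRsep, by linarith, by linarith,
        by ring, ?_, rfl⟩) ?_
      · rw [hprepR, LinearMap.comp_apply, hTX, bellPower_eq_maxEntangled]
        refine (half_traceNorm_isotropic_le (by ring)).trans ?_
        rw [hlpF, abs_le]
        have h2 := le_max_left (1 - ε) F
        have h3 : max (1 - ε) F ≤ 1 := max_le (by linarith) hF1
        constructor <;> linarith
      · rw [EReal.coe_le_coe_iff]
        have h2 : (1 - ε) / F ≤ (c + 1) / 2 := by
          rw [div_lt_iff₀ (by linarith)] at hF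
          rw [div_le_iff₀ hF0]
          linarith
        have h3 : lp ≤ (c + 1) / 2 := max_le h2 (by linarith [hc.2])
        linarith
    · refine le_sInf ?_
      rintro _ ⟨lp, lm, Λp, Λm, hΛp, hΛm, hlp, hlm, hl, herr, rfl⟩
      rw [bellPower_eq_maxEntangled] at herr
      have h1 := le_mul_overlap_of_traceNorm_le (hstate Λp hΛp) (hstate Λm hΛm) hlm hl herr
      have h2 := h1.trans (mul_le_mul_of_nonneg_left (hle Λp hΛp) hlp)
      rw [EReal.coe_le_coe_iff]
      -- The bound by `1` is `lm ≥ 0`; the other is `1 - ε ≤ lp * f` with `lp + lm = 2 * lp - 1`.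
      refine max_le ?_ (by linarith)
      have h3 : 2 * (1 - ε) / f ≤ 2 * lp := by
        rw [div_le_iff₀ hfpos]
        linarith
      linarith
  · intro hclosed
    have hcomp' := isCompact_of_isClosed_channels hclosed (by
      rintro _ ⟨Λ, hΛ, rfl⟩
      exact ⟨Λ, (hsep _ _ _ _ Λ hΛ).1, rfl⟩)
    have hcont : Continuous fun g : Matrix (A × B) (A × B) ℂ →
        Matrix (Qubits m × Qubits m) (Qubits m × Qubits m) ℂ =>
        (g ρ * bellPower m).trace.re :=
      Complex.continuous_re.comp (Continuous.matrix_trace (by fun_prop))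
    obtain ⟨_, ⟨Λ, hΛ, rfl⟩, hmax⟩ := hcomp'.exists_isMaxOn ⟨_, Λ₀, hΛ₀, rfl⟩ hcont.continuousOn
    refine ⟨Λ, hΛ, le_antisymm (le_csSup hbdd ⟨Λ, hΛ, rfl⟩) (csSup_le hne ?_)⟩
    rintro _ ⟨Λ', hΛ', rfl⟩
    exact hmax ⟨Λ', hΛ', rfl⟩
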